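/- Let $d\ge 0$ be an integer, $\alpha\in[1,2]$, and let $\mu$ be a probability law on $\mathbb{R}^d$. The law of a random vector $\xi$ in $\mathbb{R}^d$ is called \emph{symmetric $\alpha$-stable} ($S\alpha S$) if $\xi$ and $-\xi$ have the same distribution and, for all $a,b>0$, the vector $a^{1/\alpha}\xi_1+b^{1/\alpha}\xi_2$ has the same distribution as $(a+b)^{1/\alpha}\xi$, where $\xi_1,\xi_2$ are independent copies of $\xi$. An $S\alpha S$ law is called \emph{sub-Gaussian with characteristic exponent $\alpha$} if its characteristic function is $u\mapsto \exp(-\|u\|_E^\alpha)$, where $\|u\|_E=\inf\{s\ge 0: u\in sE\}$ is the Minkowski functional of some centred ellipsoid $E=\{u\in\mathbb{R}^d:\langle Cu,u\rangle\le 1\}$ with $C$ a symmetric positive definite matrix (for $\alpha=2$ these are the non-degenerate centred normal laws). Then $\mu$ is $S\alpha S$ if and only if there is a sequence $(\nu_n)$ of probability laws converging weakly to $\mu$ such that each $\nu_n$ is the law of a sum of finitely many (at least one) independent random vectors, each having a sub-Gaussian law with the same characteristic exponent $\alpha$. -/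

import Mathlib

open MeasureTheory

/-- A probability law `μ` on `ℝᵈ` is symmetric `α`-stable (`SαS`): it is invariant under `x ↦ -x`
and, if `ξ₁, ξ₂` are independent with law `μ`, then for all `a, b > 0` the vector
`a^{1/α} ξ₁ + b^{1/α} ξ₂` has the law of `(a+b)^{1/α} ξ₁`. -/
def IsSymmetricStable {d : ℕ} (α : ℝ) (μ : ProbabilityMeasure (EuclideanSpace ℝ (Fin d))) : Prop :=
  (μ : Measure (EuclideanSpace ℝ (Fin d))).map (fun x => -x) = μ ∧
    ∀ a b : ℝ, 0 < a → 0 < b →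
      ((μ : Measure (EuclideanSpace ℝ (Fin d))).prod μ).map
          (fun p => a ^ (1 / α) • p.1 + b ^ (1 / α) • p.2) =
        (μ : Measure (EuclideanSpace ℝ (Fin d))).map (fun x => (a + b) ^ (1 / α) • x)

/-- A centred ellipsoid `{u : ⟨Cu, u⟩ ≤ 1}` in `ℝᵈ`, with `C` symmetric positive definite. -/
def IsCentredEllipsoid {d : ℕ} (E : Set (EuclideanSpace ℝ (Fin d))) : Prop :=
  ∃ C : Matrix (Fin d) (Fin d) ℝ, C.PosDef ∧
    E = {u | inner ℝ (Matrix.toEuclideanLin C u) u ≤ 1}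

/-- `F` is an associated star body of the law `μ` for the exponent `α`: the characteristic function
of `μ` at `u` is `exp (-‖u‖_F ^ α)`, where `‖·‖_F` is the Minkowski functional of `F`. -/
def IsAssociatedStarBody {d : ℕ} (α : ℝ) (μ : ProbabilityMeasure (EuclideanSpace ℝ (Fin d)))
    (F : Set (EuclideanSpace ℝ (Fin d))) : Prop :=
  ∀ u, charFun (μ : Measure (EuclideanSpace ℝ (Fin d))) u =
    ((Real.exp (-(gauge F u ^ α)) : ℝ) : ℂ)

/-- A sub-Gaussian (elliptically contoured stable) law with characteristic exponent `α`: an `SαS`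
law whose associated star body is a centred ellipsoid. -/
def IsSubGaussianStable {d : ℕ} (α : ℝ)
    (μ : ProbabilityMeasure (EuclideanSpace ℝ (Fin d))) : Prop :=
  IsSymmetricStable α μ ∧ ∃ E, IsCentredEllipsoid E ∧ IsAssociatedStarBody α μ E

/-- `μ` is the law of `ξ₁ + ⋯ + ξₘ` for some `m ≥ 1` and independent random vectors `ξᵢ` with
sub-Gaussian laws of exponent `α`. -/
def IsSumOfIndepSubGaussianStable {d : ℕ} (α : ℝ)
    (μ : ProbabilityMeasure (EuclideanSpace ℝ (Fin d))) : Prop :=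
  ∃ (m : ℕ) (ν : Fin m → ProbabilityMeasure (EuclideanSpace ℝ (Fin d))),
    0 < m ∧ (∀ i, IsSubGaussianStable α (ν i)) ∧
      (μ : Measure (EuclideanSpace ℝ (Fin d))) =
        (Measure.pi fun i => (ν i : Measure (EuclideanSpace ℝ (Fin d)))).map
          (fun x => ∑ i, x i)

/-! The backward implication holds because, by `isSymmetricStable_iff_charFun`, stability is a
family of pointwise identities between values of the characteristic function, and these survive
finite products and pointwise limits.

For the forward implication, write the characteristic function of `μ` as `exp (-ψ)` with `ψ ≥ 0`
homogeneous of degree `α` (`IsSymmetricStable.exists_exponent`). It suffices to approximate `ψ`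
pointwise by finite sums of `⟨Cᵢu, u⟩ ^ (α / 2)`. No spectral measure is used; `μ` itself serves as
mixing measure. For `p < α` the moment `∫ |⟨x, u⟩| ^ p ∂μ`, times a constant `c`, equals `ψ u ^ (p /
α)`. Replacing `|⟨x, u⟩| ^ p` by `‖x‖ ^ (p - α) * |⟨x, u⟩| ^ α` costs at most `(1 - p / α) * ‖x‖ ^
p` on the unit ball (`abs_inner_rpow_sub_bounds`), and `c * ∫ ‖x‖ ^ p ∂μ` is bounded independently
of `p`. The replacement is a mixture of functions `|⟨y, u⟩| ^ α`, which are uniform limits of powers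
of ellipsoidal norms, so it lies in the closure of the convex set of exponents. Then let `p → α`.

Each ellipsoidal exponent does come from a law: a Gaussian for `α = 2`, and for `α < 2` a limit of
sums of Gaussians with random Pareto variance (`exists_charFun_eq_exp_neg_rpow`). -/

/-! ### Integrals against `t ^ (-1 - p)` -/

lemma integrableOn_mul_rpow_of_abs_le {g : ℝ → ℝ} (hg : Measurable g) {A B p q : ℝ} (hp : 0 < p)
    (hpq : p < q) (hA : ∀ t, 0 < t → |g t| ≤ A * t ^ q) (hB : ∀ t, 0 < t → |g t| ≤ B) :
    IntegrableOn (fun t => g t * t ^ (-1 - p)) (Set.Ioi 0) := by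
  have hm : Measurable fun t : ℝ => g t * t ^ (-1 - p) := by fun_prop
  rw [← Set.Ioc_union_Ioi_eq_Ioi zero_le_one]
  refine IntegrableOn.union ?_ ?_
  · have h : IntegrableOn (fun t : ℝ => A * t ^ (q - 1 - p)) (Set.Ioc 0 1) := by
      rw [← intervalIntegrable_iff_integrableOn_Ioc_of_le zero_le_one]
      exact (intervalIntegral.intervalIntegrable_rpow' (by linarith)).const_mul A
    refine h.mono' hm.aestronglyMeasurable ?_
    refine (ae_restrict_iff' measurableSet_Ioc).2 (.of_forall fun t ht => ?_)
    rw [Real.norm_eq_abs, abs_mul, abs_of_nonneg (Real.rpow_nonneg ht.1.le (-1 - p)),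
      show q - 1 - p = q + (-1 - p) by ring, Real.rpow_add ht.1, ← mul_assoc]
    exact mul_le_mul_of_nonneg_right (hA t ht.1) (Real.rpow_nonneg ht.1.le _)
  · have h : IntegrableOn (fun t : ℝ => B * t ^ (-1 - p)) (Set.Ioi 1) :=
      (integrableOn_Ioi_rpow_of_lt (by linarith) zero_lt_one).const_mul B
    refine h.mono' hm.aestronglyMeasurable ?_
    refine (ae_restrict_iff' measurableSet_Ioi).2 (.of_forall fun t ht => ?_)
    have ht0 : (0 : ℝ) < t := zero_lt_one.trans ht
    rw [Real.norm_eq_abs, abs_mul, abs_of_nonneg (Real.rpow_nonneg ht0.le (-1 - p))]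
    exact mul_le_mul_of_nonneg_right (hB t ht0) (Real.rpow_nonneg ht0.le _)

/-- Change of variables. All the fractional powers below, of quadratic forms, of projections and of
`ψ`, are produced by this scaling. -/
lemma integral_comp_mul_mul_rpow {g : ℝ → ℝ} (hg : g 0 = 0) {p s : ℝ} (hp : 0 < p) (hs : 0 ≤ s) :
    ∫ t in Set.Ioi (0 : ℝ), g (s * t) * t ^ (-1 - p) =
      s ^ p * ∫ t in Set.Ioi (0 : ℝ), g t * t ^ (-1 - p) := by
  rcases hs.eq_or_lt with rfl | hs
  · simp [hg, Real.zero_rpow hp.ne']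
  have h := integral_comp_mul_left_Ioi (fun t => g t * t ^ (-1 - p)) 0 hs
  rw [mul_zero, smul_eq_mul] at h
  have h2 : ∫ t in Set.Ioi (0 : ℝ), g (s * t) * t ^ (-1 - p) =
      s ^ (1 + p) * ∫ t in Set.Ioi (0 : ℝ), g (s * t) * (s * t) ^ (-1 - p) := by
    rw [← integral_const_mul]
    refine setIntegral_congr_fun measurableSet_Ioi fun t ht => ?_
    have ht : 0 < t := ht
    have e : s ^ (1 + p) * s ^ (-1 - p) = 1 := by
      rw [← Real.rpow_add hs]; simp
    rw [Real.mul_rpow hs.le ht.le]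
    linear_combination (-(g (s * t) * t ^ (-1 - p))) * e
  rw [h2, h, ← mul_assoc, Real.rpow_add hs, Real.rpow_one, mul_comm s, mul_assoc (s ^ p),
    mul_inv_cancel₀ hs.ne', mul_one]

lemma integral_mul_rpow_pos {g : ℝ → ℝ} {p : ℝ} (h0 : ∀ t, 0 < t → 0 ≤ g t)
    (h1 : ∀ t ∈ Set.Ioo (0 : ℝ) 1, 0 < g t)
    (hi : IntegrableOn (fun t => g t * t ^ (-1 - p)) (Set.Ioi 0)) :
    0 < ∫ t in Set.Ioi (0 : ℝ), g t * t ^ (-1 - p) := by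
  rw [setIntegral_pos_iff_support_of_nonneg_ae _ hi]
  · refine lt_of_lt_of_le ?_ (measure_mono (s := Set.Ioo (0 : ℝ) 1) fun t ht =>
      ⟨(mul_pos (h1 t ht) (Real.rpow_pos_of_pos ht.1 _)).ne', ht.1⟩)
    simp
  · refine (ae_restrict_iff' measurableSet_Ioi).2 (.of_forall fun t ht => ?_)
    exact mul_nonneg (h0 t ht) (Real.rpow_nonneg (le_of_lt ht) _)

lemma integrableOn_one_sub_exp_neg_rpow {α p : ℝ} (hp : 0 < p) (hpα : p < α) :
    IntegrableOn (fun t : ℝ => (1 - Real.exp (-t ^ α)) * t ^ (-1 - p)) (Set.Ioi 0) := by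
  refine integrableOn_mul_rpow_of_abs_le (by fun_prop) (A := 1) (B := 1) hp hpα
    (fun t ht => ?_) (fun t ht => ?_)
  all_goals
    have h : 0 < t ^ α := Real.rpow_pos_of_pos ht _
    have h1 := Real.add_one_le_exp (-t ^ α)
    have h2 : Real.exp (-t ^ α) ≤ 1 := Real.exp_le_one_iff.2 (by linarith)
    have h3 := Real.exp_pos (-t ^ α)
    rw [abs_of_nonneg (by linarith)]
    linarith

lemma integral_one_sub_exp_neg_rpow_pos {α p : ℝ} (hp : 0 < p) (hpα : p < α) :
    0 < ∫ t in Set.Ioi (0 : ℝ), (1 - Real.exp (-t ^ α)) * t ^ (-1 - p) := by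
  have h : ∀ t : ℝ, 0 < t → 0 < 1 - Real.exp (-t ^ α) := fun t ht =>
    sub_pos.2 (Real.exp_lt_one_iff.2 (by linarith [Real.rpow_pos_of_pos ht α]))
  exact integral_mul_rpow_pos (g := fun t => 1 - Real.exp (-t ^ α)) (fun t ht => (h t ht).le)
    (fun t ht => h t ht.1) (integrableOn_one_sub_exp_neg_rpow hp hpα)

lemma integrableOn_one_sub_cos {p : ℝ} (hp : 0 < p) (hp2 : p < 2) :
    IntegrableOn (fun t : ℝ => (1 - Real.cos t) * t ^ (-1 - p)) (Set.Ioi 0) := by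
  refine integrableOn_mul_rpow_of_abs_le (by fun_prop) (A := 1) (B := 2) hp hp2
    (fun t ht => ?_) (fun t ht => ?_)
  all_goals
    have h1 := Real.one_sub_sq_div_two_le_cos (x := t)
    have h2 := Real.cos_le_one t
    have h3 := Real.neg_one_le_cos t
    rw [abs_of_nonneg (by linarith)]
  · rw [Real.rpow_two]; nlinarith
  · linarith

lemma integral_one_sub_cos_pos {p : ℝ} (hp : 0 < p) (hp2 : p < 2) :
    0 < ∫ t in Set.Ioi (0 : ℝ), (1 - Real.cos t) * t ^ (-1 - p) := by
  refine integral_mul_rpow_pos (g := fun t => 1 - Real.cos t)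
    (fun t _ => sub_nonneg.2 (Real.cos_le_one t)) (fun t ht => ?_) (integrableOn_one_sub_cos hp hp2)
  have h := Real.cos_lt_cos_of_nonneg_of_le_pi le_rfl (by linarith [ht.2, Real.pi_gt_three]) ht.1
  rw [Real.cos_zero] at h
  exact sub_pos.2 h

/-! ### Minkowski functional of an ellipsoid -/

lemma sqrt_le_iff_inv_smul_mem {r q : ℝ} (hr : 0 < r) : r⁻¹ ^ 2 * q ≤ 1 ↔ √q ≤ r := by
  rw [Real.sqrt_le_left hr.le, inv_pow, inv_mul_le_iff₀ (by positivity), mul_one]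

lemma gauge_centredEllipsoid {d : ℕ} {C : Matrix (Fin d) (Fin d) ℝ}
    (u : EuclideanSpace ℝ (Fin d)) :
    gauge {u : EuclideanSpace ℝ (Fin d) | inner ℝ (Matrix.toEuclideanLin C u) u ≤ 1} u =
      √(inner ℝ (Matrix.toEuclideanLin C u) u) := by
  have h : {r ∈ Set.Ioi (0 : ℝ) | r⁻¹ • u ∈ {u : EuclideanSpace ℝ (Fin d) |
      inner ℝ (Matrix.toEuclideanLin C u) u ≤ 1}} =
      Set.Ioi 0 ∩ Set.Ici √(inner ℝ (Matrix.toEuclideanLin C u) u) := by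
    ext r
    refine and_congr_right fun hr => ?_
    rw [Set.mem_ofPred_eq, map_smul, real_inner_smul_left, real_inner_smul_right, ← mul_assoc,
      ← sq, sqrt_le_iff_inv_smul_mem hr, Set.mem_Ici]
  rw [gauge_def', h]
  -- If the root vanishes, the admissible scales form the open ray, whose infimum is still the root.
  rcases (Real.sqrt_nonneg (inner ℝ (Matrix.toEuclideanLin C u) u)).eq_or_lt with h0 | h0
  · rw [← h0, Set.inter_eq_left.2 Set.Ioi_subset_Ici_self, csInf_Ioi]
  · rw [Set.inter_eq_right.2 (Set.Ici_subset_Ioi.2 h0), csInf_Ici]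

/-! ### Stability through characteristic functions -/

section

variable {d : ℕ}

lemma isSymmetricStable_iff_charFun {α : ℝ} {μ : ProbabilityMeasure (EuclideanSpace ℝ (Fin d))} :
    IsSymmetricStable α μ ↔
      (∀ u, charFun (μ : Measure (EuclideanSpace ℝ (Fin d))) (-u) = charFun (μ : Measure _) u) ∧
      ∀ a b : ℝ, 0 < a → 0 < b → ∀ u,
        charFun (μ : Measure (EuclideanSpace ℝ (Fin d))) (a ^ (1 / α) • u) *
          charFun (μ : Measure (EuclideanSpace ℝ (Fin d))) (b ^ (1 / α) • u) =
        charFun (μ : Measure (EuclideanSpace ℝ (Fin d))) ((a + b) ^ (1 / α) • u) := by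
  set m : Measure (EuclideanSpace ℝ (Fin d)) := (μ : Measure (EuclideanSpace ℝ (Fin d))) with hmdef
  have hm (r : ℝ) : IsProbabilityMeasure (m.map (r • ·)) :=
    Measure.isProbabilityMeasure_map (by fun_prop)
  have hneg : m.map (fun x => -x) = m.map ((-1 : ℝ) • ·) := by simp
  have key (a b : ℝ) (u) : charFun ((m.prod m).map (fun p => a • p.1 + b • p.2)) u =
      charFun m (a • u) * charFun m (b • u) := by
    have h : (m.prod m).map (fun p => a • p.1 + b • p.2) =
        ((m.map (a • ·)).prod (m.map (b • ·))).map (fun p => p.1 + p.2) := by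
      rw [Measure.map_prod_map _ _ (by fun_prop) (by fun_prop),
        Measure.map_map (by fun_prop) (by fun_prop)]
      rfl
    rw [h, ProbabilityTheory.charFun_map_add_prod_eq_mul, Pi.mul_apply, charFun_map_smul,
      charFun_map_smul]
  have h2 (a b : ℝ) : IsProbabilityMeasure ((m.prod m).map (fun p => a • p.1 + b • p.2)) :=
    Measure.isProbabilityMeasure_map (by fun_prop)
  unfold IsSymmetricStable
  rw [← hmdef]
  refine and_congr ⟨fun h u => ?_, fun h => ?_⟩
    (forall₄_congr fun a b ha hb => ⟨fun h u => ?_, fun h => ?_⟩)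
  · have := congrArg (fun ν => charFun ν u) h
    simpa [hneg, charFun_map_smul] using this
  · rw [hneg]
    refine Measure.ext_of_charFun (funext fun u => ?_)
    rw [charFun_map_smul, neg_one_smul, h]
  · rw [← key, h, charFun_map_smul]
  · refine Measure.ext_of_charFun (funext fun u => ?_)
    rw [key, charFun_map_smul, h]

/-! ### Subordination by Pareto mixtures -/

/-- Given the Pareto variable `s`, the vector has characteristic function `exp (-s q)`; integrating
the deficit `1 - exp (-s q)` against the Pareto density gives the formula. -/
lemma charFun_paretoMixture {E : Type*} [NormedAddCommGroup E] [InnerProductSpace ℝ E]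
    [FiniteDimensional ℝ E] [MeasurableSpace E] [BorelSpace E] {γ : Measure E}
    [IsProbabilityMeasure γ] {q : E → ℝ}
    (hγ : ∀ u, charFun γ u = ((Real.exp (-q u) : ℝ) : ℂ)) (hq : ∀ (r : ℝ) u, q (r • u) = r ^ 2 * q u)
    (hq0 : ∀ u, 0 ≤ q u)
    {t β : ℝ} (ht : 0 < t) (hβ : 0 < β) (u : E) :
    charFun (((ProbabilityTheory.paretoMeasure t β).prod γ).map fun p => √p.1 • p.2) u =
      ((1 - β * t ^ β * ∫ s in Set.Ioi t, (1 - Real.exp (-(s * q u))) * s ^ (-1 - β) : ℝ) : ℂ) := by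
  have := ProbabilityTheory.isProbabilityMeasure_paretoMeasure ht hβ
  set P := ProbabilityTheory.paretoMeasure t β with hP
  have hi : Integrable (fun p : ℝ × E => Complex.exp (inner ℝ (√p.1 • p.2) u * Complex.I))
      (P.prod γ) := by
    refine (integrable_const (1 : ℝ)).mono' (Measurable.aestronglyMeasurable (by fun_prop)) ?_
    exact .of_forall fun p => by rw [Complex.norm_exp_ofReal_mul_I]
  -- The truncation `max s 0` is the square of `√s` for every real `s`, so the identity needs no
  -- restriction to the support.
  have h1 : charFun ((P.prod γ).map fun p => √p.1 • p.2) u =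
      ∫ s, ((Real.exp (-(max s 0 * q u)) : ℝ) : ℂ) ∂P := by
    rw [charFun_apply, integral_map (by fun_prop)
      (Measurable.aestronglyMeasurable (by fun_prop)), integral_prod _ hi]
    refine integral_congr_ae (.of_forall fun s => ?_)
    have h := hγ (√s • u)
    rw [hq, Real.sq_sqrt', charFun_apply] at h
    simp only [real_inner_smul_left, real_inner_smul_right] at h ⊢
    exact h
  have hi2 : Integrable (fun s => Real.exp (-(max s 0 * q u))) P := by
    refine (integrable_const (1 : ℝ)).mono' (Measurable.aestronglyMeasurable (by fun_prop)) ?_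
    refine .of_forall fun s => ?_
    rw [Real.norm_eq_abs, Real.abs_exp, Real.exp_le_one_iff, neg_nonpos]
    exact mul_nonneg (le_max_right _ _) (hq0 u)
  rw [h1, integral_complex_ofReal]
  congr 1
  have h2 : ∫ s, (1 - Real.exp (-(max s 0 * q u))) ∂P =
      β * t ^ β * ∫ s in Set.Ioi t, (1 - Real.exp (-(s * q u))) * s ^ (-1 - β) := by
    have hmeas : Measurable (ProbabilityTheory.paretoPDF t β) :=
      (ProbabilityTheory.measurable_paretoPDFReal t β).ennreal_ofReal
    rw [hP, ProbabilityTheory.paretoMeasure, integral_withDensity_eq_integral_toReal_smul hmeas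
      (.of_forall fun s => ENNReal.ofReal_lt_top),
      ← integral_const_mul, ← integral_Ici_eq_integral_Ioi, ← integral_indicator measurableSet_Ici]
    refine integral_congr_ae (.of_forall fun s => ?_)
    dsimp only [ProbabilityTheory.paretoPDF]
    rw [ENNReal.toReal_ofReal (ProbabilityTheory.paretoPDFReal_nonneg ht.le hβ.le s),
      ProbabilityTheory.paretoPDFReal]
    by_cases hs : t ≤ s
    · rw [if_pos hs, Set.indicator_of_mem (Set.mem_Ici.2 hs), max_eq_left (ht.le.trans hs),
        smul_eq_mul, show -(β + 1) = -1 - β by ring]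
      ring
    · rw [if_neg hs, Set.indicator_of_notMem (by simpa using hs), zero_smul]
  rw [← h2, integral_sub (integrable_const _) hi2]
  simp

lemma tendsto_setIntegral_Ioi {f : ℝ → ℝ} {t : ℕ → ℝ} (hf : IntegrableOn f (Set.Ioi 0))
    (ht0 : ∀ n, 0 ≤ t n) (ht : Filter.Tendsto t Filter.atTop (nhds 0)) :
    Filter.Tendsto (fun n => ∫ s in Set.Ioi (t n), f s) Filter.atTop
      (nhds (∫ s in Set.Ioi 0, f s)) := by
  simp_rw [← integral_indicator measurableSet_Ioi]
  refine tendsto_integral_of_dominated_convergence (fun s => |(Set.Ioi 0).indicator f s|)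
    (fun n => ?_) ?_ (fun n => .of_forall fun s => ?_) (.of_forall fun s => ?_)
  · exact (integrable_indicator_iff measurableSet_Ioi).2
      (hf.mono_set (Set.Ioi_subset_Ioi (ht0 n))) |>.aestronglyMeasurable
  · exact ((integrable_indicator_iff measurableSet_Ioi).2 hf).abs
  · by_cases hs : t n < s
    · rw [Set.indicator_of_mem (Set.mem_Ioi.2 hs),
        Set.indicator_of_mem (Set.mem_Ioi.2 ((ht0 n).trans_lt hs)), Real.norm_eq_abs]
    · rw [Set.indicator_of_notMem (by simpa using hs), norm_zero]
      exact abs_nonneg _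
  · by_cases hs : 0 < s
    · rw [Set.indicator_of_mem (Set.mem_Ioi.2 hs)]
      refine tendsto_const_nhds.congr' ?_
      filter_upwards [ht.eventually_lt_const hs] with n hn
      rw [Set.indicator_of_mem (Set.mem_Ioi.2 hn)]
    · rw [Set.indicator_of_notMem (by simpa using hs)]
      refine tendsto_const_nhds.congr fun n => ?_
      rw [Set.indicator_of_notMem]
      exact fun h => hs ((ht0 n).trans_lt h)

/-- Subordination: if `exp (-q)` is the characteristic function of a law, `q` being a nonnegative
quadratic form, then so is `exp (-q ^ β)` for `0 < β < 1`. -/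
lemma exists_charFun_eq_exp_neg_rpow {E : Type*} [NormedAddCommGroup E] [InnerProductSpace ℝ E]
    [FiniteDimensional ℝ E] [MeasurableSpace E] [BorelSpace E] (γ : Measure E)
    [IsProbabilityMeasure γ] {q : E → ℝ}
    (hγ : ∀ u, charFun γ u = ((Real.exp (-q u) : ℝ) : ℂ)) (hq : ∀ (r : ℝ) u, q (r • u) = r ^ 2 * q u)
    (hq0 : ∀ u, 0 ≤ q u) (hqc : Continuous q) {β : ℝ} (hβ : 0 < β) (hβ1 : β < 1) :
    ∃ ν : ProbabilityMeasure E, ∀ u,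
      charFun (ν : Measure E) u = ((Real.exp (-q u ^ β) : ℝ) : ℂ) := by
  -- The threshold solves `(n + 1) * t ^ β = 1`: the product of the `n + 1` equal factors `1 - (n +
  -- 1)⁻¹ * β ∫_{s > t}` then tends to `exp (-β ∫_{s > 0}) = exp (-c q ^ β)`.
  set t : ℕ → ℝ := fun n => ((n : ℝ) + 1)⁻¹ ^ β⁻¹ with ht
  have ht0 n : 0 < t n := by positivity
  have htβ n : t n ^ β = ((n : ℝ) + 1)⁻¹ := Real.rpow_inv_rpow (by positivity) hβ.ne'
  have htl : Filter.Tendsto t Filter.atTop (nhds 0) := by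
    have h := (tendsto_one_div_add_atTop_nhds_zero_nat (𝕜 := ℝ)).rpow_const
      (p := β⁻¹) (Or.inr (by positivity))
    rw [Real.zero_rpow (by positivity)] at h
    simpa [ht] using h
  have hpar n := ProbabilityTheory.isProbabilityMeasure_paretoMeasure (ht0 n) hβ
  let m (n : ℕ) : Measure E :=
    ((ProbabilityTheory.paretoMeasure (t n) β).prod γ).map fun p => √p.1 • p.2
  have hm n : IsProbabilityMeasure (m n) := Measure.isProbabilityMeasure_map (by fun_prop)
  let ν (n : ℕ) : ProbabilityMeasure E :=
    ⟨(Measure.pi fun _ : Fin (n + 1) => m n).map (fun x => ∑ i, x i),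
      Measure.isProbabilityMeasure_map (by fun_prop)⟩
  set K := ∫ s in Set.Ioi (0 : ℝ), (1 - Real.exp (-s ^ (1 : ℝ))) * s ^ (-1 - β) with hK
  have hK0 : 0 < K := integral_one_sub_exp_neg_rpow_pos hβ hβ1
  set c := β * K with hc
  have hc0 : 0 < c := mul_pos hβ hK0
  have hint (v : ℝ) (hv : 0 ≤ v) : IntegrableOn
      (fun s : ℝ => (1 - Real.exp (-(s * v))) * s ^ (-1 - β)) (Set.Ioi 0) := by
    refine integrableOn_mul_rpow_of_abs_le (by fun_prop) (A := v) (B := 1) hβ hβ1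
      (fun s hs => ?_) (fun s hs => ?_)
    all_goals
      have h := mul_nonneg hs.le hv
      have h1 := Real.add_one_le_exp (-(s * v))
      have h2 : Real.exp (-(s * v)) ≤ 1 := Real.exp_le_one_iff.2 (by linarith)
      have h3 := Real.exp_pos (-(s * v))
      rw [abs_of_nonneg (by linarith)]
      try rw [Real.rpow_one]
      linarith
  have hlim u : Filter.Tendsto (fun n => charFun (ν n : Measure E) u) Filter.atTop
      (nhds ((Real.exp (-(c * q u ^ β)) : ℝ) : ℂ)) := by
    have e n : charFun (ν n : Measure E) u = (((1 + -(((n + 1 : ℕ) : ℝ)⁻¹ *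
        (β * ∫ s in Set.Ioi (t n), (1 - Real.exp (-(s * q u))) * s ^ (-1 - β)))) ^ (n + 1) : ℝ) :
        ℂ) := by
      change charFun ((Measure.pi fun _ : Fin (n + 1) => m n).map (fun x => ∑ i, x i)) u = _
      rw [ProbabilityTheory.charFun_map_sum_pi_eq_prod, Finset.prod_apply, Finset.prod_const,
        Finset.card_univ, Fintype.card_fin]
      simp only [m]
      rw [charFun_paretoMixture hγ hq hq0 (ht0 n) hβ, ← Complex.ofReal_pow, htβ]
      congr 2
      push_cast
      ring
    simp_rw [e]
    refine (Complex.continuous_ofReal.tendsto _).comp ?_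
    have hI := tendsto_setIntegral_Ioi (hint (q u) (hq0 u)) (fun n => (ht0 n).le) htl
    have hI2 : ∫ s in Set.Ioi (0 : ℝ), (1 - Real.exp (-(s * q u))) * s ^ (-1 - β) =
        q u ^ β * K := by
      rw [hK, ← integral_comp_mul_mul_rpow (g := fun s => 1 - Real.exp (-s ^ (1 : ℝ)))
        (by simp) hβ (hq0 u)]
      simp [mul_comm]
    rw [hI2] at hI
    have hpow (a : ℕ → ℝ) {l : ℝ} (ha : Filter.Tendsto a Filter.atTop (nhds l)) :
        Filter.Tendsto (fun n : ℕ => (1 + -(((n + 1 : ℕ) : ℝ)⁻¹ * a n)) ^ (n + 1)) Filter.atTop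
          (nhds (Real.exp (-l))) := by
      -- The sequence is shifted by one so that the power matches the index; the value at `n = 0` is
      -- irrelevant.
      have h := Real.tendsto_one_add_pow_exp_of_tendsto
        (g := fun n => -((n : ℝ)⁻¹ * a (n - 1))) (t := -l) ?_
      · exact ((Filter.tendsto_add_atTop_iff_nat 1).2 h)
      · refine ((ha.comp (Filter.tendsto_sub_atTop_nat 1)).neg).congr' ?_
        filter_upwards [Filter.eventually_gt_atTop 0] with n hn
        have : (n : ℝ) ≠ 0 := by positivity
        simp [this]
    have := hpow _ (hI.const_mul β)
    rwa [show β * (q u ^ β * K) = c * q u ^ β by rw [hc]; ring] at this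
  have hcont : ContinuousAt (fun u => ((Real.exp (-(c * q u ^ β)) : ℝ) : ℂ)) 0 := by
    refine Continuous.continuousAt ?_
    have : Continuous fun u => q u ^ β := hqc.rpow_const fun _ => Or.inr hβ.le
    fun_prop
  -- Continuity of the limit at `0` gives tightness; Prokhorov's theorem then supplies a law having
  -- that limit as characteristic function.
  have htight := isTightMeasureSet_of_tendsto_charFun hcont hlim
  have hcomp := isCompact_closure_of_isTightMeasureSet (S := Set.range ν) (by
    convert htight using 1
    ext; simp)
  obtain ⟨ν₀, -, φ, hφ, hν₀⟩ := hcomp.tendsto_subseq (fun n => subset_closure ⟨n, rfl⟩)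
  rw [ProbabilityMeasure.tendsto_iff_tendsto_charFun] at hν₀
  have h0 u : charFun (ν₀ : Measure E) u = ((Real.exp (-(c * q u ^ β)) : ℝ) : ℂ) :=
    tendsto_nhds_unique (hν₀ u) ((hlim u).comp hφ.tendsto_atTop)
  -- Rescaling by `r` multiplies `q ^ β` by `(r ^ 2) ^ β = c⁻¹`, which removes the constant.
  set r : ℝ := c ^ (-(2 * β)⁻¹) with hr
  refine ⟨⟨(ν₀ : Measure E).map (r • ·), Measure.isProbabilityMeasure_map (by fun_prop)⟩,
    fun u => ?_⟩
  change charFun ((ν₀ : Measure E).map (r • ·)) u = _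
  rw [charFun_map_smul, h0, hq, Real.mul_rpow (by positivity) (hq0 u), ← mul_assoc]
  have : c * (r ^ 2) ^ β = 1 := by
    rw [hr, ← Real.rpow_natCast, ← Real.rpow_mul hc0.le, ← Real.rpow_mul hc0.le]
    rw [show -(2 * β)⁻¹ * ((2 : ℕ) : ℝ) * β = -1 by push_cast; field_simp, Real.rpow_neg_one]
    exact mul_inv_cancel₀ hc0.ne'
  rw [this, one_mul]

/-! ### Sub-Gaussian laws, their sums and their limits -/

lemma gauge_centredEllipsoid_rpow {C : Matrix (Fin d) (Fin d) ℝ} {α : ℝ}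
    {u : EuclideanSpace ℝ (Fin d)} (hu : 0 ≤ inner ℝ (Matrix.toEuclideanLin C u) u) :
    gauge {u : EuclideanSpace ℝ (Fin d) | inner ℝ (Matrix.toEuclideanLin C u) u ≤ 1} u ^ α =
      inner ℝ (Matrix.toEuclideanLin C u) u ^ (α / 2) := by
  rw [gauge_centredEllipsoid, Real.sqrt_eq_rpow, ← Real.rpow_mul hu]
  congr 1
  ring

lemma isSymmetricStable_of_charFun_eq_exp_neg {α : ℝ} (hα : 0 < α)
    {μ : ProbabilityMeasure (EuclideanSpace ℝ (Fin d))} {f : EuclideanSpace ℝ (Fin d) → ℝ}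
    (hμ : ∀ u, charFun (μ : Measure (EuclideanSpace ℝ (Fin d))) u = ((Real.exp (-f u) : ℝ) : ℂ))
    (hneg : ∀ u, f (-u) = f u) (hf : ∀ r : ℝ, 0 < r → ∀ u, f (r • u) = r ^ α * f u) :
    IsSymmetricStable α μ := by
  refine isSymmetricStable_iff_charFun.2 ⟨fun u => by rw [hμ, hμ, hneg], fun a b ha hb u => ?_⟩
  have h (a : ℝ) (ha : 0 < a) : f (a ^ (1 / α) • u) = a * f u := by
    rw [hf _ (by positivity), one_div, Real.rpow_inv_rpow ha.le hα.ne']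
  rw [hμ, hμ, hμ, h a ha, h b hb, h _ (add_pos ha hb), ← Complex.ofReal_mul, ← Real.exp_add]
  congr 2
  ring

lemma IsSumOfIndepSubGaussianStable.isSymmetricStable {α : ℝ}
    {μ : ProbabilityMeasure (EuclideanSpace ℝ (Fin d))} (h : IsSumOfIndepSubGaussianStable α μ) :
    IsSymmetricStable α μ := by
  obtain ⟨m, ν, -, hν, hμ⟩ := h
  have hν' i := isSymmetricStable_iff_charFun.1 (hν i).1
  rw [isSymmetricStable_iff_charFun, hμ, ProbabilityTheory.charFun_map_sum_pi_eq_prod]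
  simp only [Finset.prod_apply]
  refine ⟨fun u => Finset.prod_congr rfl fun i _ => (hν' i).1 u, fun a b ha hb u => ?_⟩
  rw [← Finset.prod_mul_distrib]
  exact Finset.prod_congr rfl fun i _ => (hν' i).2 a b ha hb u

lemma IsSymmetricStable.of_tendsto {α : ℝ} {μ : ProbabilityMeasure (EuclideanSpace ℝ (Fin d))}
    {ν : ℕ → ProbabilityMeasure (EuclideanSpace ℝ (Fin d))} (hν : ∀ n, IsSymmetricStable α (ν n))
    (h : Filter.Tendsto ν Filter.atTop (nhds μ)) : IsSymmetricStable α μ := by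
  rw [ProbabilityMeasure.tendsto_iff_tendsto_charFun] at h
  have hν' n := isSymmetricStable_iff_charFun.1 (hν n)
  refine isSymmetricStable_iff_charFun.2 ⟨fun u => ?_, fun a b ha hb u => ?_⟩
  · exact tendsto_nhds_unique ((h (-u)).congr fun n => (hν' n).1 u) (h u)
  · exact tendsto_nhds_unique
      (((h (a ^ (1 / α) • u)).mul (h (b ^ (1 / α) • u))).congr fun n => (hν' n).2 a b ha hb u)
      (h _)

lemma Matrix.PosSemidef.inner_toEuclideanLin_nonneg {C : Matrix (Fin d) (Fin d) ℝ}
    (hC : C.PosSemidef) (u : EuclideanSpace ℝ (Fin d)) :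
    0 ≤ inner ℝ (Matrix.toEuclideanLin C u) u := by
  have h := hC.dotProduct_mulVec_nonneg u.ofLp
  simpa [EuclideanSpace.inner_eq_star_dotProduct, Matrix.toLpLin_apply, dotProduct_comm] using h

lemma inner_toEuclideanLin_smul (C : Matrix (Fin d) (Fin d) ℝ) (r : ℝ)
    (u : EuclideanSpace ℝ (Fin d)) :
    inner ℝ (Matrix.toEuclideanLin C (r • u)) (r • u) =
      r ^ 2 * inner ℝ (Matrix.toEuclideanLin C u) u := by
  rw [map_smul, real_inner_smul_left, real_inner_smul_right]
  ring

/-- Every centred ellipsoid is the associated star body of a sub-Gaussian law. -/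
lemma exists_isSubGaussianStable {α : ℝ} (hα : 0 < α) (hα2 : α ≤ 2)
    {C : Matrix (Fin d) (Fin d) ℝ} (hC : C.PosDef) :
    ∃ ν : ProbabilityMeasure (EuclideanSpace ℝ (Fin d)), IsSubGaussianStable α ν ∧
      ∀ u, charFun (ν : Measure (EuclideanSpace ℝ (Fin d))) u =
        ((Real.exp (-inner ℝ (Matrix.toEuclideanLin C u) u ^ (α / 2)) : ℝ) : ℂ) := by
  set q : EuclideanSpace ℝ (Fin d) → ℝ := fun u => inner ℝ (Matrix.toEuclideanLin C u) u with hq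
  have hq0 : ∀ u, 0 ≤ q u := hC.posSemidef.inner_toEuclideanLin_nonneg
  have hqs : ∀ (r : ℝ) u, q (r • u) = r ^ 2 * q u := inner_toEuclideanLin_smul C
  have hqc : Continuous q :=
    (LinearMap.continuous_of_finiteDimensional (Matrix.toEuclideanLin C)).inner continuous_id
  -- The factor `√2` cancels the one half in the Gaussian exponent.
  let γ := (ProbabilityTheory.multivariateGaussian 0 C).map ((√2 : ℝ) • ·)
  have hγp : IsProbabilityMeasure γ := Measure.isProbabilityMeasure_map (by fun_prop)
  have hγ u : charFun γ u = ((Real.exp (-q u) : ℝ) : ℂ) := by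
    have h1 (v : EuclideanSpace ℝ (Fin d)) : v.ofLp ⬝ᵥ C.mulVec v.ofLp = q v := by
      simp [hq, EuclideanSpace.inner_eq_star_dotProduct, Matrix.toLpLin_apply]
    rw [charFun_map_smul, ProbabilityTheory.charFun_multivariateGaussian hC.posSemidef,
      h1, hqs, Real.sq_sqrt zero_le_two, inner_zero_right]
    push_cast
    congr 1
    ring
  have hex : ∃ ν : ProbabilityMeasure (EuclideanSpace ℝ (Fin d)),
      ∀ u, charFun (ν : Measure (EuclideanSpace ℝ (Fin d))) u =
        ((Real.exp (-q u ^ (α / 2)) : ℝ) : ℂ) := by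
    rcases hα2.eq_or_lt with rfl | hα2
    · exact ⟨⟨γ, hγp⟩, fun u => by simpa using hγ u⟩
    · exact exists_charFun_eq_exp_neg_rpow γ hγ hqs hq0 hqc (by linarith) (by linarith)
  obtain ⟨ν, hν⟩ := hex
  refine ⟨ν, ⟨isSymmetricStable_of_charFun_eq_exp_neg hα hν (fun u => ?_) (fun r hr u => ?_),
    _, ⟨C, hC, rfl⟩, fun u => ?_⟩, hν⟩
  · rw [← neg_one_smul ℝ u, hqs]
    norm_num
  · rw [hqs, Real.mul_rpow (by positivity) (hq0 u), ← Real.rpow_natCast, ← Real.rpow_mul hr.le]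
    congr 2
    push_cast
    ring
  · rw [hν, gauge_centredEllipsoid_rpow (hq0 u)]

/-! ### The cone of ellipsoidal exponents -/

/-- The functions `∑ ‖·‖_{Eᵢ} ^ α` for finite nonempty families of centred ellipsoids `Eᵢ`. -/
def ellipsoidExponents (d : ℕ) (α : ℝ) : Set (EuclideanSpace ℝ (Fin d) → ℝ) :=
  {f | ∃ (m : ℕ) (C : Fin m → Matrix (Fin d) (Fin d) ℝ), 0 < m ∧ (∀ i, (C i).PosDef) ∧
    ∀ u, f u = ∑ i, inner ℝ (Matrix.toEuclideanLin (C i) u) u ^ (α / 2)}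

lemma ellipsoidExponents_add {α : ℝ} {f g : EuclideanSpace ℝ (Fin d) → ℝ}
    (hf : f ∈ ellipsoidExponents d α) (hg : g ∈ ellipsoidExponents d α) :
    f + g ∈ ellipsoidExponents d α := by
  obtain ⟨m, C, hm, hC, hf⟩ := hf
  obtain ⟨k, D, -, hD, hg⟩ := hg
  refine ⟨m + k, Fin.append C D, by omega, fun i => ?_, fun u => ?_⟩
  · refine Fin.addCases (fun i => ?_) (fun i => ?_) i
    · simpa using hC i
    · simpa using hD i
  · simp [Fin.sum_univ_add, hf, hg]

lemma ellipsoidExponents_smul {α c : ℝ} (hα : 0 < α) (hc : 0 < c)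
    {f : EuclideanSpace ℝ (Fin d) → ℝ} (hf : f ∈ ellipsoidExponents d α) :
    c • f ∈ ellipsoidExponents d α := by
  obtain ⟨m, C, hm, hC, hf⟩ := hf
  refine ⟨m, fun i => c ^ (α / 2)⁻¹ • C i, hm, fun i => (hC i).smul (by positivity), fun u => ?_⟩
  simp only [Pi.smul_apply, hf, smul_eq_mul, Finset.mul_sum]
  refine Finset.sum_congr rfl fun i _ => ?_
  rw [map_smul, LinearMap.smul_apply, real_inner_smul_left, Real.mul_rpow (by positivity)
    ((hC i).posSemidef.inner_toEuclideanLin_nonneg u), Real.rpow_inv_rpow hc.le (by positivity)]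

lemma ellipsoidExponents_apply_smul {α : ℝ} {f : EuclideanSpace ℝ (Fin d) → ℝ}
    (hf : f ∈ ellipsoidExponents d α) {r : ℝ} (hr : 0 < r) (u : EuclideanSpace ℝ (Fin d)) :
    f (r • u) = r ^ α * f u := by
  obtain ⟨m, C, hm, hC, hf⟩ := hf
  rw [hf, hf, Finset.mul_sum]
  refine Finset.sum_congr rfl fun i _ => ?_
  rw [inner_toEuclideanLin_smul, Real.mul_rpow (by positivity)
    ((hC i).posSemidef.inner_toEuclideanLin_nonneg u), ← Real.rpow_natCast, ← Real.rpow_mul hr.le]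
  congr 2
  push_cast
  ring

lemma exists_isSumOfIndepSubGaussianStable {α : ℝ} (hα : 0 < α) (hα2 : α ≤ 2)
    {f : EuclideanSpace ℝ (Fin d) → ℝ} (hf : f ∈ ellipsoidExponents d α) :
    ∃ ν : ProbabilityMeasure (EuclideanSpace ℝ (Fin d)), IsSumOfIndepSubGaussianStable α ν ∧
      ∀ u, charFun (ν : Measure (EuclideanSpace ℝ (Fin d))) u =
        ((Real.exp (-f u) : ℝ) : ℂ) := by
  obtain ⟨m, C, hm, hC, hf⟩ := hf
  choose ν hν hνc using fun i => exists_isSubGaussianStable hα hα2 (hC i)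
  refine ⟨⟨(Measure.pi fun i => (ν i : Measure (EuclideanSpace ℝ (Fin d)))).map
      (fun x => ∑ i, x i), Measure.isProbabilityMeasure_map (by fun_prop)⟩,
    ⟨m, ν, hm, hν, rfl⟩, fun u => ?_⟩
  change charFun ((Measure.pi fun i => (ν i : Measure (EuclideanSpace ℝ (Fin d)))).map
      (fun x => ∑ i, x i)) u = _
  rw [ProbabilityTheory.charFun_map_sum_pi_eq_prod, Finset.prod_apply, hf, ← Finset.sum_neg_distrib,
    Real.exp_sum, Complex.ofReal_prod]
  exact Finset.prod_congr rfl fun i _ => hνc i u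

/-! ### The exponent of a stable law -/

/-- Cauchy's equation: nonnegativity makes `h` monotone, and bracketing `n * t` between consecutive
integers bounds `n * |h t - t * h 1|` by `h 1` for every `n`. -/
lemma eq_mul_of_add_of_nonneg {h : ℝ → ℝ} (h0 : ∀ t, 0 ≤ t → 0 ≤ h t)
    (hadd : ∀ a b, 0 ≤ a → 0 ≤ b → h (a + b) = h a + h b) {t : ℝ} (ht : 0 ≤ t) :
    h t = t * h 1 := by
  have hz : h 0 = 0 := by simpa using hadd 0 0 le_rfl le_rfl
  have hmono {a b : ℝ} (ha : 0 ≤ a) (hab : a ≤ b) : h a ≤ h b := by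
    have := hadd a (b - a) ha (sub_nonneg.2 hab)
    rw [add_sub_cancel] at this
    linarith [h0 _ (sub_nonneg.2 hab)]
  have hnat (n : ℕ) {s : ℝ} (hs : 0 ≤ s) : h (n * s) = n * h s := by
    induction n with
    | zero => simp [hz]
    | succ n ih => rw [Nat.cast_succ, add_one_mul, hadd _ _ (by positivity) hs, ih]; ring
  have h1 := h0 1 zero_le_one
  have key (n : ℕ) : n * |h t - t * h 1| ≤ h 1 := by
    have a1 := hmono (Nat.cast_nonneg _) (Nat.floor_le (show 0 ≤ n * t by positivity))
    have a2 := hmono (show 0 ≤ n * t by positivity) (Nat.lt_floor_add_one (n * t : ℝ)).le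
    have b1 := hnat ⌊n * t⌋₊ zero_le_one
    have b2 := hnat (⌊n * t⌋₊ + 1) zero_le_one
    rw [mul_one] at b1 b2
    push_cast at b2
    rw [hnat n ht] at a1 a2
    rw [b1] at a1
    rw [b2] at a2
    have c1 := Nat.floor_le (show 0 ≤ n * t by positivity)
    have c2 := (Nat.lt_floor_add_one (n * t : ℝ)).le
    rw [← abs_of_nonneg (Nat.cast_nonneg (α := ℝ) n), ← abs_mul, abs_le]
    constructor <;> nlinarith
  by_contra hne
  have hpos : 0 < |h t - t * h 1| := abs_pos.2 (sub_ne_zero.2 hne)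
  obtain ⟨n, hn⟩ := exists_nat_gt (h 1 / |h t - t * h 1|)
  rw [div_lt_iff₀ hpos] at hn
  exact (key n).not_gt hn

/-- The characteristic function of a symmetric stable law is `exp (-ψ)` with `ψ ≥ 0` homogeneous
of degree `α`. -/
lemma IsSymmetricStable.exists_exponent {α : ℝ} (hα : 0 < α)
    {μ : ProbabilityMeasure (EuclideanSpace ℝ (Fin d))} (hμ : IsSymmetricStable α μ) :
    ∃ ψ : EuclideanSpace ℝ (Fin d) → ℝ, (∀ u, 0 ≤ ψ u) ∧
      (∀ u, charFun (μ : Measure (EuclideanSpace ℝ (Fin d))) u = ((Real.exp (-ψ u) : ℝ) : ℂ)) ∧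
      ∀ r, 0 ≤ r → ∀ u, ψ (r • u) = r ^ α * ψ u := by
  obtain ⟨hs, hst⟩ := isSymmetricStable_iff_charFun.1 hμ
  set φ := charFun (μ : Measure (EuclideanSpace ℝ (Fin d))) with hφ
  have hre u : φ u = ((φ u).re : ℂ) := by
    have h := hs u
    rw [hφ, charFun_neg] at h
    exact (Complex.conj_eq_iff_re.1 h).symm
  have hφ0 : φ 0 = 1 := by simp [hφ]
  have hstr {a b : ℝ} (ha : 0 < a) (hb : 0 < b) (u) :
      (φ (a ^ (1 / α) • u)).re * (φ (b ^ (1 / α) • u)).re = (φ ((a + b) ^ (1 / α) • u)).re := by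
    have h := hst a b ha hb u
    rw [hre (a ^ (1 / α) • u), hre (b ^ (1 / α) • u), ← Complex.ofReal_mul] at h
    rw [← h, Complex.ofReal_re]
  set ρ : ℝ := (2⁻¹ : ℝ) ^ (1 / α) with hρ
  have hρ1 : ρ < 1 := Real.rpow_lt_one (by norm_num) (by norm_num) (by positivity)
  have hsq u : (φ u).re = (φ (ρ • u)).re ^ 2 := by
    have h := hstr (a := 2⁻¹) (b := 2⁻¹) (by norm_num) (by norm_num) u
    rw [show (2⁻¹ + 2⁻¹ : ℝ) = 1 by norm_num, Real.one_rpow, one_smul] at h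
    rw [← h, sq]
  -- A zero at `u` would propagate through `hsq` to all `ρ ^ n • u`, which tend to `0`, where `φ` is
  -- `1`.
  have hpos u : 0 < (φ u).re := by
    refine lt_of_le_of_ne (by rw [hsq]; positivity) fun h0 => ?_
    have hz (n : ℕ) : (φ (ρ ^ n • u)).re = 0 := by
      induction n with
      | zero => simpa using h0.symm
      | succ n ih =>
        rw [hsq, smul_smul, ← pow_succ'] at ih
        exact pow_eq_zero_iff two_ne_zero |>.1 ih
    have hc : Filter.Tendsto (fun n : ℕ => (φ (ρ ^ n • u)).re) Filter.atTop (nhds (φ 0).re) := by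
      have h1 : Continuous φ := by fun_prop
      have h2 := (tendsto_pow_atTop_nhds_zero_of_lt_one (show 0 ≤ ρ by positivity) hρ1).smul_const u
      rw [zero_smul] at h2
      exact ((Complex.continuous_re.comp h1).tendsto 0).comp h2
    simp only [hz, hφ0, Complex.one_re] at hc
    exact zero_ne_one (tendsto_nhds_unique tendsto_const_nhds hc)
  refine ⟨fun u => -Real.log (φ u).re, fun u => ?_, fun u => ?_, fun r hr u => ?_⟩
  · refine neg_nonneg.2 (Real.log_nonpos (hpos u).le ?_)
    exact (Complex.re_le_norm _).trans (norm_charFun_le_one u)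
  · rw [neg_neg, Real.exp_log (hpos u)]
    exact hre u
  -- Stability says that `t ↦ ψ (t ^ (1 / α) • u)` is additive, hence linear; evaluate it at `t = r
  -- ^ α`.
  · have h := eq_mul_of_add_of_nonneg (h := fun t => -Real.log (φ (t ^ (1 / α) • u)).re)
      (fun t _ => ?_) (fun a b ha hb => ?_) (show 0 ≤ r ^ α by positivity)
    · rwa [one_div, Real.rpow_rpow_inv hr hα.ne', Real.one_rpow, one_smul] at h
    · refine neg_nonneg.2 (Real.log_nonpos (hpos _).le ?_)
      exact (Complex.re_le_norm _).trans (norm_charFun_le_one _)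
    · have hz : (0 : ℝ) ^ (1 / α) = 0 := Real.zero_rpow (by positivity)
      rcases ha.eq_or_lt with rfl | ha
      · simp only [hz, zero_add, zero_smul, hφ0, Complex.one_re, Real.log_one, neg_zero]
      rcases hb.eq_or_lt with rfl | hb
      · simp only [hz, add_zero, zero_smul, hφ0, Complex.one_re, Real.log_one, neg_zero]
      · rw [← hstr ha hb, Real.log_mul (hpos _).ne' (hpos _).ne']
        ring

/-! ### Fractional moments of projections -/

lemma integral_cos_inner {μ : Measure (EuclideanSpace ℝ (Fin d))} [IsProbabilityMeasure μ]
    (v : EuclideanSpace ℝ (Fin d)) :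
    ∫ x, Real.cos (inner ℝ x v) ∂μ = (charFun μ v).re := by
  have hi : Integrable (fun x => Complex.exp (inner ℝ x v * Complex.I)) μ := by
    refine (integrable_const (1 : ℝ)).mono' (Measurable.aestronglyMeasurable (by fun_prop)) ?_
    exact .of_forall fun p => by rw [Complex.norm_exp_ofReal_mul_I]
  rw [charFun_apply]
  refine Eq.trans ?_ (integral_re hi)
  exact integral_congr_ae (.of_forall fun x => by simp [Complex.exp_ofReal_mul_I_re])

/-- Fractional moments of the one-dimensional projections of a stable law. -/
lemma integrable_and_integral_abs_inner_rpow {α p : ℝ} (hp : 0 < p) (hpα : p < α) (hα2 : α ≤ 2)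
    {μ : Measure (EuclideanSpace ℝ (Fin d))} [IsProbabilityMeasure μ]
    {ψ : EuclideanSpace ℝ (Fin d) → ℝ} (hψ0 : ∀ u, 0 ≤ ψ u)
    (hψ : ∀ u, charFun μ u = ((Real.exp (-ψ u) : ℝ) : ℂ))
    (hψh : ∀ r, 0 ≤ r → ∀ u, ψ (r • u) = r ^ α * ψ u) (u : EuclideanSpace ℝ (Fin d)) :
    Integrable (fun x => |inner ℝ x u| ^ p) μ ∧
      (∫ x, |inner ℝ x u| ^ p ∂μ) * ∫ t in Set.Ioi (0 : ℝ), (1 - Real.cos t) * t ^ (-1 - p) =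
        ψ u ^ (p / α) * ∫ t in Set.Ioi (0 : ℝ), (1 - Real.exp (-t ^ α)) * t ^ (-1 - p) := by
  have hα : 0 < α := hp.trans hpα
  set F : ℝ × EuclideanSpace ℝ (Fin d) → ℝ :=
    fun z => (1 - Real.cos (z.1 * inner ℝ z.2 u)) * z.1 ^ (-1 - p) with hF
  have hFm : Measurable F := by fun_prop
  have hcosi (t : ℝ) : Integrable (fun x => 1 - Real.cos (t * inner ℝ x u)) μ := by
    refine (integrable_const (2 : ℝ)).mono' (Measurable.aestronglyMeasurable (by fun_prop)) ?_
    refine .of_forall fun x => ?_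
    rw [Real.norm_eq_abs, abs_le]
    constructor <;> linarith [Real.neg_one_le_cos (t * inner ℝ x u),
      Real.cos_le_one (t * inner ℝ x u)]
  -- `t ^ α * ψ u` is written as `(ψ u ^ α⁻¹ * t) ^ α` so that the scaling lemma applies with factor
  -- `ψ u ^ α⁻¹`.
  have hx (t : ℝ) (ht : 0 < t) : ∫ x, F (t, x) ∂μ =
      (1 - Real.exp (-(ψ u ^ α⁻¹ * t) ^ α)) * t ^ (-1 - p) := by
    simp only [hF]
    rw [integral_mul_const]
    congr 1
    have hci : Integrable (fun x => Real.cos (t * inner ℝ x u)) μ :=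
      ((integrable_const (1 : ℝ)).sub (hcosi t)).congr (.of_forall fun x => sub_sub_cancel _ _)
    rw [integral_sub (integrable_const _) hci]
    have := integral_cos_inner (μ := μ) (t • u)
    simp only [real_inner_smul_right] at this
    rw [this, hψ, Complex.ofReal_re, hψh t ht.le, Real.mul_rpow (Real.rpow_nonneg (hψ0 u) _) ht.le,
      Real.rpow_inv_rpow (hψ0 u) hα.ne', mul_comm (ψ u)]
    simp
  -- Since `F ≥ 0` for `t > 0`, integrability is checked by integrating over `x` first, where the
  -- characteristic function is explicit. Fubini in the other order then yields finiteness of the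
  -- moment as well as its value.
  have hFint : Integrable F ((volume.restrict (Set.Ioi 0)).prod μ) := by
    rw [integrable_prod_iff hFm.aestronglyMeasurable]
    refine ⟨.of_forall fun t => (hcosi t).mul_const (t ^ (-1 - p)), ?_⟩
    have hI : IntegrableOn (fun t : ℝ => (1 - Real.exp (-(ψ u ^ α⁻¹ * t) ^ α)) * t ^ (-1 - p))
        (Set.Ioi 0) := by
      refine integrableOn_mul_rpow_of_abs_le (by fun_prop) (A := ψ u) (B := 1) hp hpα
        (fun t ht => ?_) (fun t ht => ?_)
      all_goals
        rw [Real.mul_rpow (Real.rpow_nonneg (hψ0 u) _) ht.le, Real.rpow_inv_rpow (hψ0 u) hα.ne']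
        have h : 0 ≤ ψ u * t ^ α := mul_nonneg (hψ0 u) (Real.rpow_nonneg ht.le _)
        have h1 := Real.add_one_le_exp (-(ψ u * t ^ α))
        have h2 : Real.exp (-(ψ u * t ^ α)) ≤ 1 := Real.exp_le_one_iff.2 (by linarith)
        have h3 := Real.exp_pos (-(ψ u * t ^ α))
        rw [abs_of_nonneg (by linarith)]
        linarith
    refine hI.congr ?_
    refine (ae_restrict_iff' measurableSet_Ioi).2 (.of_forall fun t ht => ?_)
    refine (hx t ht).symm.trans (integral_congr_ae (.of_forall fun x => ?_))
    refine (Real.norm_of_nonneg ?_).symm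
    exact mul_nonneg (sub_nonneg.2 (Real.cos_le_one _)) (Real.rpow_nonneg (le_of_lt ht) _)
  set k := ∫ t in Set.Ioi (0 : ℝ), (1 - Real.cos t) * t ^ (-1 - p) with hk
  have hk0 : 0 < k := integral_one_sub_cos_pos hp (hpα.trans_le hα2)
  have ht x : ∫ t in Set.Ioi (0 : ℝ), F (t, x) = |inner ℝ x u| ^ p * k := by
    rw [hk, ← integral_comp_mul_mul_rpow (g := fun t => 1 - Real.cos t) (by simp) hp
      (abs_nonneg (inner ℝ x u))]
    refine setIntegral_congr_fun measurableSet_Ioi fun t ht => ?_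
    have ht : 0 < t := ht
    simp only [hF]
    rw [← Real.cos_abs, abs_mul, abs_of_pos ht, mul_comm t]
  constructor
  · have h := hFint.integral_prod_right
    simp only [ht] at h
    refine (h.mul_const k⁻¹).congr (.of_forall fun x => ?_)
    exact mul_inv_cancel_right₀ hk0.ne' _
  · have h := integral_integral_swap (f := fun t x => F (t, x)) hFint
    simp only [ht] at h
    rw [← integral_mul_const, ← h, setIntegral_congr_fun measurableSet_Ioi hx,
      integral_comp_mul_mul_rpow (g := fun t => 1 - Real.exp (-t ^ α))
        (by simp [Real.zero_rpow hα.ne']) hp (Real.rpow_nonneg (hψ0 u) _),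
      ← Real.rpow_mul (hψ0 u)]
    congr 2
    ring

/-! ### Approximation on the unit ball -/

/-- Subadditivity of `t ↦ t ^ (p / 2)` applied to `∑ xᵢ ^ 2`; it reduces the moment of the norm to
moments of projections. -/
lemma norm_rpow_le_sum_abs_inner_rpow {p : ℝ} (hp : 0 < p) (hp2 : p ≤ 2)
    (x : EuclideanSpace ℝ (Fin d)) :
    ‖x‖ ^ p ≤ ∑ i, |inner ℝ x (EuclideanSpace.single i (1 : ℝ))| ^ p := by
  have h := Finset.le_sum_of_subadditive_on_pred (fun t : ℝ => t ^ (p / 2)) (fun t => 0 ≤ t)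
    (Real.zero_rpow (by positivity)).le
    (fun a b ha hb => Real.rpow_add_le_add_rpow ha hb (by positivity) (by linarith))
    (fun a b ha hb => add_nonneg ha hb) (fun i => |x i| ^ 2) (s := Finset.univ)
    (fun i _ => by positivity)
  have e (a : ℝ) (ha : 0 ≤ a) : (a ^ 2) ^ (p / 2) = a ^ p := by
    rw [← Real.rpow_natCast, ← Real.rpow_mul ha]
    congr 1
    push_cast
    ring
  simp only [e _ (abs_nonneg _)] at h
  rw [← e _ (norm_nonneg x), EuclideanSpace.real_norm_sq_eq]
  simpa [EuclideanSpace.inner_single_right] using h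

/-- With `s = |⟨x, u⟩| / ‖x‖ ∈ [0, 1]` the difference is `(s ^ p - s ^ α) * ‖x‖ ^ p`, and weighted
AM-GM gives `s ^ p ≤ (p / α) * s ^ α + (1 - p / α)`. -/
lemma abs_inner_rpow_sub_bounds {p α : ℝ} (hp : 0 < p) (hpα : p ≤ α)
    (x : EuclideanSpace ℝ (Fin d)) {u : EuclideanSpace ℝ (Fin d)} (hu : ‖u‖ ≤ 1) :
    0 ≤ |inner ℝ x u| ^ p - ‖x‖ ^ (p - α) * |inner ℝ x u| ^ α ∧
      |inner ℝ x u| ^ p - ‖x‖ ^ (p - α) * |inner ℝ x u| ^ α ≤ (1 - p / α) * ‖x‖ ^ p := by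
  have hα : 0 < α := hp.trans_le hpα
  rcases (norm_nonneg x).eq_or_lt with h0 | h0
  · have hx : x = 0 := norm_eq_zero.1 h0.symm
    simp [hx, Real.zero_rpow hp.ne', Real.zero_rpow hα.ne']
  set s := |inner ℝ x u| / ‖x‖ with hs
  have hs0 : 0 ≤ s := by positivity
  have hs1 : s ≤ 1 := by
    refine div_le_one_of_le₀ ((abs_real_inner_le_norm x u).trans ?_) h0.le
    exact mul_le_of_le_one_right h0.le hu
  have hi : |inner ℝ x u| = ‖x‖ * s := by rw [hs, mul_div_cancel₀ _ h0.ne']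
  have he : |inner ℝ x u| ^ p - ‖x‖ ^ (p - α) * |inner ℝ x u| ^ α = (s ^ p - s ^ α) * ‖x‖ ^ p := by
    rw [hi, Real.mul_rpow h0.le hs0, Real.mul_rpow h0.le hs0, ← mul_assoc, ← Real.rpow_add h0,
      sub_add_cancel]
    ring
  have hN : 0 ≤ ‖x‖ ^ p := by positivity
  rw [he]
  constructor
  · refine mul_nonneg (sub_nonneg.2 ?_) hN
    rcases hs0.eq_or_lt with h | h
    · rw [← h, Real.zero_rpow hp.ne', Real.zero_rpow hα.ne']
    · exact Real.rpow_le_rpow_of_exponent_ge h hs1 hpα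
  · refine mul_le_mul_of_nonneg_right ?_ hN
    have h := Real.geom_mean_le_arith_mean2_weighted (w₁ := p / α) (w₂ := 1 - p / α)
      (p₁ := s ^ α) (p₂ := 1) (by positivity) (by rw [sub_nonneg, div_le_one hα]; exact hpα)
      (by positivity) zero_le_one (by ring)
    rw [← Real.rpow_mul hs0, mul_div_cancel₀ _ hα.ne', Real.one_rpow, mul_one, mul_one] at h
    have h2 : p / α * s ^ α ≤ s ^ α :=
      mul_le_of_le_one_left (by positivity) (by rw [div_le_one hα]; exact hpα)
    linarith

/-- The restrictions to the unit ball of the functions in `ellipsoidExponents d α`. -/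
def ellipsoidExponentsBall (d : ℕ) (α : ℝ) :
    Set C(Metric.closedBall (0 : EuclideanSpace ℝ (Fin d)) 1, ℝ) :=
  {F | ∃ f ∈ ellipsoidExponents d α, ∀ u : Metric.closedBall (0 : EuclideanSpace ℝ (Fin d)) 1,
    F u = f u}

lemma convex_ellipsoidExponentsBall {α : ℝ} (hα : 0 < α) :
    Convex ℝ (ellipsoidExponentsBall d α) := by
  refine convex_iff_forall_pos.2 ?_
  rintro F ⟨f, hf, hF⟩ G ⟨g, hg, hG⟩ a b ha hb -
  exact ⟨a • f + b • g, ellipsoidExponents_add (ellipsoidExponents_smul hα ha hf)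
    (ellipsoidExponents_smul hα hb hg), fun u => by simp [hF, hG]⟩

/-- The map sending `y` to the function `u ↦ |⟪y, u⟫| ^ α` on the unit ball. -/
noncomputable def absInnerRpow (d : ℕ) {α : ℝ} (hα : 0 < α) :
    C(EuclideanSpace ℝ (Fin d), C(Metric.closedBall (0 : EuclideanSpace ℝ (Fin d)) 1, ℝ)) :=
  ContinuousMap.curry ⟨fun z => |inner ℝ z.1 (z.2 : EuclideanSpace ℝ (Fin d))| ^ α,
    Continuous.rpow_const (by fun_prop) fun _ => Or.inr hα.le⟩

lemma absInnerRpow_apply {α : ℝ} (hα : 0 < α) (y : EuclideanSpace ℝ (Fin d))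
    (u : Metric.closedBall (0 : EuclideanSpace ℝ (Fin d)) 1) :
    absInnerRpow d hα y u = |inner ℝ y (u : EuclideanSpace ℝ (Fin d))| ^ α := rfl

/-- The rank-one form `⟨y, u⟩ ^ 2` becomes positive definite after adding `δ ^ 2 * ‖u‖ ^ 2`. Joint
continuity in `(δ, u)` and compactness of the ball make the convergence uniform as `δ → 0`. -/
lemma absInnerRpow_mem_closure {α : ℝ} (hα : 0 < α) (y : EuclideanSpace ℝ (Fin d)) :
    absInnerRpow d hα y ∈ closure (ellipsoidExponentsBall d α) := by
  let G : C(ℝ, C(Metric.closedBall (0 : EuclideanSpace ℝ (Fin d)) 1, ℝ)) :=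
    ContinuousMap.curry ⟨fun z => (inner ℝ y (z.2 : EuclideanSpace ℝ (Fin d)) ^ 2 +
      z.1 ^ 2 * ‖(z.2 : EuclideanSpace ℝ (Fin d))‖ ^ 2) ^ (α / 2),
      Continuous.rpow_const (by fun_prop) fun _ => Or.inr (by positivity)⟩
  have hG (δ : ℝ) (u : Metric.closedBall (0 : EuclideanSpace ℝ (Fin d)) 1) :
      G δ u = (inner ℝ y (u : EuclideanSpace ℝ (Fin d)) ^ 2 +
        δ ^ 2 * ‖(u : EuclideanSpace ℝ (Fin d))‖ ^ 2) ^ (α / 2) := rfl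
  have hG0 : G 0 = absInnerRpow d hα y := by
    ext u
    rw [hG, absInnerRpow_apply, ← sq_abs, ← Real.rpow_natCast, zero_pow two_ne_zero, zero_mul,
      add_zero, ← Real.rpow_mul (abs_nonneg _)]
    congr 1
    push_cast
    ring
  rw [← hG0]
  refine mem_closure_of_tendsto ((G.continuous.tendsto 0).mono_left nhdsWithin_le_nhds)
    (b := nhdsWithin 0 {0}ᶜ) ?_
  filter_upwards [self_mem_nhdsWithin] with δ hδ
  have hδ : δ ≠ 0 := hδ
  let C : Matrix (Fin d) (Fin d) ℝ := Matrix.vecMulVec y.ofLp y.ofLp + δ ^ 2 • 1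
  have hC : C.PosDef := Matrix.PosDef.posSemidef_add
    (by simpa using Matrix.posSemidef_vecMulVec_self_star y.ofLp)
    (Matrix.PosDef.one.smul (by positivity))
  refine ⟨_, ⟨1, fun _ => C, one_pos, fun _ => hC, fun u => rfl⟩, fun u => ?_⟩
  rw [hG, Fin.sum_univ_one]
  congr 1
  simp only [C, map_add, LinearMap.add_apply, inner_add_left, map_smul, LinearMap.smul_apply,
    real_inner_smul_left]
  congr 1
  · simp [EuclideanSpace.inner_eq_star_dotProduct, Matrix.toLpLin_apply, Matrix.vecMulVec_mulVec,
      dotProduct_comm, sq]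
  · simp

/-- On the unit ball, the exponent of a stable law is approximated by sums of powers of Minkowski
functionals of ellipsoids. -/
lemma exists_ellipsoidExponents_approx {α p ε : ℝ} (hp : 0 < p) (hpα : p < α) (hα2 : α ≤ 2)
    (hε : 0 < ε) {μ : Measure (EuclideanSpace ℝ (Fin d))} [IsProbabilityMeasure μ]
    {ψ : EuclideanSpace ℝ (Fin d) → ℝ} (hψ0 : ∀ u, 0 ≤ ψ u)
    (hψ : ∀ u, charFun μ u = ((Real.exp (-ψ u) : ℝ) : ℂ))
    (hψh : ∀ r, 0 ≤ r → ∀ u, ψ (r • u) = r ^ α * ψ u) :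
    ∃ f ∈ ellipsoidExponents d α, ∀ u, ‖u‖ ≤ 1 → |ψ u ^ (p / α) - f u| ≤
      (1 - p / α) * ∑ i : Fin d, (1 + ψ (EuclideanSpace.single i 1)) + ε := by
  have hα : 0 < α := hp.trans hpα
  have hr0 : 0 ≤ 1 - p / α := by rw [sub_nonneg, div_le_one hα]; exact hpα.le
  have hmom u := integrable_and_integral_abs_inner_rpow hp hpα hα2 hψ0 hψ hψh u
  set k := ∫ t in Set.Ioi (0 : ℝ), (1 - Real.cos t) * t ^ (-1 - p)
  have hk : 0 < k := integral_one_sub_cos_pos hp (hpα.trans_le hα2)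
  set l := ∫ t in Set.Ioi (0 : ℝ), (1 - Real.exp (-t ^ α)) * t ^ (-1 - p)
  have hl : 0 < l := integral_one_sub_exp_neg_rpow_pos hp hpα
  -- Normalises the moment identity to `c * ∫ |⟨x, u⟩| ^ p ∂μ = ψ u ^ (p / α)`.
  set c := k / l with hc
  have hc0 : 0 < c := div_pos hk hl
  have hcm u : c * ∫ x, |inner ℝ x u| ^ p ∂μ = ψ u ^ (p / α) := by
    rw [hc, div_mul_eq_mul_div, mul_comm, (hmom u).2, mul_div_cancel_right₀ _ hl.ne']
  have hsum : Integrable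
      (fun x => ∑ i, |inner ℝ x (EuclideanSpace.single i (1 : ℝ) : EuclideanSpace ℝ (Fin d))| ^ p)
      μ := integrable_finsetSum _ fun i _ => (hmom _).1
  have hnorm : Integrable (fun x : EuclideanSpace ℝ (Fin d) => ‖x‖ ^ p) μ := by
    refine hsum.mono' (Measurable.aestronglyMeasurable (by fun_prop)) (.of_forall fun x => ?_)
    rw [Real.norm_of_nonneg (by positivity)]
    exact norm_rpow_le_sum_abs_inner_rpow hp (hpα.le.trans hα2) x
  -- The bound must not depend on `p`, whence `ψ ^ (p / α) ≤ 1 + ψ`.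
  have hnormle : c * ∫ x, ‖x‖ ^ p ∂μ ≤ ∑ i : Fin d, (1 + ψ (EuclideanSpace.single i 1)) := by
    calc c * ∫ x, ‖x‖ ^ p ∂μ
        ≤ c * ∫ x, ∑ i, |inner ℝ x (EuclideanSpace.single i (1 : ℝ))| ^ p ∂μ := by
          refine mul_le_mul_of_nonneg_left (integral_mono hnorm hsum fun x => ?_) hc0.le
          exact norm_rpow_le_sum_abs_inner_rpow hp (hpα.le.trans hα2) x
      _ = ∑ i, ψ (EuclideanSpace.single i 1) ^ (p / α) := by
          rw [integral_finsetSum _ fun i _ => (hmom _).1, Finset.mul_sum]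
          exact Finset.sum_congr rfl fun i _ => hcm _
      _ ≤ _ := Finset.sum_le_sum fun i _ => by
          have h := Real.rpow_le_rpow_of_exponent_le
            (le_add_of_nonneg_right (a := (1 : ℝ)) (hψ0 (EuclideanSpace.single i 1)))
            ((div_le_one hα).2 hpα.le)
          rw [Real.rpow_one] at h
          exact (Real.rpow_le_rpow (hψ0 _) (by linarith) (by positivity)).trans h
  -- The scalar is chosen so that `|⟨y x, u⟩| ^ α` carries exactly the weight `c * ‖x‖ ^ (p - α)`.
  let y (x : EuclideanSpace ℝ (Fin d)) : EuclideanSpace ℝ (Fin d) :=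
    (c ^ α⁻¹ * ‖x‖ ^ ((p - α) / α)) • x
  have hym : Measurable y := by fun_prop
  have hy x u : |inner ℝ (y x) u| ^ α = c * (‖x‖ ^ (p - α) * |inner ℝ x u| ^ α) := by
    rw [real_inner_smul_left, abs_mul, abs_of_nonneg (by positivity),
      Real.mul_rpow (by positivity) (abs_nonneg _), Real.mul_rpow (by positivity) (by positivity),
      Real.rpow_inv_rpow hc0.le hα.ne', ← Real.rpow_mul (norm_nonneg _), div_mul_cancel₀ _ hα.ne',
      mul_assoc]
  have hbd x {u : EuclideanSpace ℝ (Fin d)} (hu : ‖u‖ ≤ 1) :=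
    abs_inner_rpow_sub_bounds hp hpα.le x hu
  have hGi : Integrable (fun x => absInnerRpow d hα (y x)) μ := by
    refine (hnorm.const_mul c).mono'
      ((absInnerRpow d hα).continuous.comp_stronglyMeasurable
        hym.stronglyMeasurable).aestronglyMeasurable (.of_forall fun x => ?_)
    rw [ContinuousMap.norm_le _ (by positivity)]
    intro u
    have hu : ‖(u : EuclideanSpace ℝ (Fin d))‖ ≤ 1 := mem_closedBall_zero_iff.1 u.2
    rw [absInnerRpow_apply, hy, Real.norm_of_nonneg (by positivity)]
    refine mul_le_mul_of_nonneg_left ?_ hc0.le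
    refine (sub_nonneg.1 (hbd x hu).1).trans ?_
    refine Real.rpow_le_rpow (abs_nonneg _) ((abs_real_inner_le_norm x u).trans ?_) hp.le
    exact mul_le_of_le_one_right (norm_nonneg x) hu
  -- A Bochner integral over a probability measure stays in a closed convex set; this replaces the
  -- mixture by finite sums, uniformly on the ball.
  have hmem : ∫ x, absInnerRpow d hα (y x) ∂μ ∈ closure (ellipsoidExponentsBall d α) :=
    (convex_ellipsoidExponentsBall hα).closure.integral_mem isClosed_closure
      (.of_forall fun x => absInnerRpow_mem_closure hα (y x)) hGi
  obtain ⟨F, ⟨f, hf, hFf⟩, hF⟩ := Metric.mem_closure_iff.1 hmem ε hε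
  refine ⟨f, hf, fun u hu => ?_⟩
  have h1 : |(∫ x, absInnerRpow d hα (y x) ∂μ) ⟨u, by simpa using hu⟩ - f u| ≤ ε := by
    have h := (ContinuousMap.dist_apply_le_dist (f := ∫ x, absInnerRpow d hα (y x) ∂μ) (g := F)
      ⟨u, by simpa using hu⟩).trans hF.le
    rwa [Real.dist_eq, hFf] at h
  rw [ContinuousMap.integral_apply hGi] at h1
  simp only [absInnerRpow_apply] at h1
  have hIy : Integrable (fun x => |inner ℝ (y x) u| ^ α) μ :=
    (ContinuousMap.evalCLM ℝ (⟨u, by simpa using hu⟩ :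
      Metric.closedBall (0 : EuclideanSpace ℝ (Fin d)) 1)).integrable_comp hGi
  have h2 : ψ u ^ (p / α) - ∫ x, |inner ℝ (y x) u| ^ α ∂μ =
      c * ∫ x, (|inner ℝ x u| ^ p - ‖x‖ ^ (p - α) * |inner ℝ x u| ^ α) ∂μ := by
    rw [← hcm, ← integral_const_mul, ← integral_sub ((hmom u).1.const_mul c) hIy,
      ← integral_const_mul]
    exact integral_congr_ae (.of_forall fun x => by simp only [hy]; ring)
  have hDi : Integrable
      (fun x => |inner ℝ x u| ^ p - ‖x‖ ^ (p - α) * |inner ℝ x u| ^ α) μ := by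
    refine (hmom u).1.sub ((hIy.const_mul c⁻¹).congr (.of_forall fun x => ?_))
    simp only [hy]
    rw [inv_mul_cancel_left₀ hc0.ne']
  have h3 : 0 ≤ ψ u ^ (p / α) - ∫ x, |inner ℝ (y x) u| ^ α ∂μ := by
    rw [h2]
    exact mul_nonneg hc0.le (integral_nonneg fun x => (hbd x hu).1)
  have h4 : ψ u ^ (p / α) - ∫ x, |inner ℝ (y x) u| ^ α ∂μ ≤
      (1 - p / α) * ∑ i : Fin d, (1 + ψ (EuclideanSpace.single i 1)) := by
    rw [h2]
    calc c * ∫ x, (|inner ℝ x u| ^ p - ‖x‖ ^ (p - α) * |inner ℝ x u| ^ α) ∂μ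
        ≤ c * ∫ x, (1 - p / α) * ‖x‖ ^ p ∂μ := mul_le_mul_of_nonneg_left
          (integral_mono hDi (hnorm.const_mul _) fun x => (hbd x hu).2) hc0.le
      _ = (1 - p / α) * (c * ∫ x, ‖x‖ ^ p ∂μ) := by rw [integral_const_mul]; ring
      _ ≤ _ := mul_le_mul_of_nonneg_left hnormle hr0
  rw [abs_le] at h1 ⊢
  constructor <;> linarith [h1.1, h1.2]

/-! ### Passage to the limit and conclusion -/

lemma exists_seq_ellipsoidExponents_tendsto {α : ℝ} (hα : 0 < α) (hα2 : α ≤ 2)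
    {μ : ProbabilityMeasure (EuclideanSpace ℝ (Fin d))} {ψ : EuclideanSpace ℝ (Fin d) → ℝ}
    (hψ0 : ∀ u, 0 ≤ ψ u)
    (hψ : ∀ u, charFun (μ : Measure (EuclideanSpace ℝ (Fin d))) u = ((Real.exp (-ψ u) : ℝ) : ℂ))
    (hψh : ∀ r, 0 ≤ r → ∀ u, ψ (r • u) = r ^ α * ψ u) :
    ∃ f : ℕ → EuclideanSpace ℝ (Fin d) → ℝ, (∀ n, f n ∈ ellipsoidExponents d α) ∧
      ∀ u, Filter.Tendsto (fun n => f n u) Filter.atTop (nhds (ψ u)) := by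
  -- Here `δ n = 1 / (n + 2)`, strictly below `1` so that `p = α * (1 - δ n)` is positive. The same
  -- `δ n` serves as `ε`.
  set δ : ℕ → ℝ := fun n => 1 / ((n + 1 : ℕ) + 1 : ℝ) with hδ
  have hδ0 n : 0 < δ n := by positivity
  have hδ1 n : δ n < 1 := by
    rw [hδ]
    exact (div_lt_one (by positivity)).2 (by push_cast; linarith [n.cast_nonneg (α := ℝ)])
  have hδl : Filter.Tendsto δ Filter.atTop (nhds 0) :=
    (Filter.tendsto_add_atTop_iff_nat 1).2 (tendsto_one_div_add_atTop_nhds_zero_nat (𝕜 := ℝ))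
  have hpα n : α * (1 - δ n) / α = 1 - δ n := mul_div_cancel_left₀ _ hα.ne'
  choose f hf hfψ using fun n => exists_ellipsoidExponents_approx (p := α * (1 - δ n))
    (mul_pos hα (sub_pos.2 (hδ1 n))) (mul_lt_of_lt_one_right hα (by linarith [hδ0 n])) hα2 (hδ0 n)
    hψ0 hψ hψh
  have hball (v : EuclideanSpace ℝ (Fin d)) (hv : ‖v‖ ≤ 1) :
      Filter.Tendsto (fun n => f n v) Filter.atTop (nhds (ψ v)) := by
    set B := ∑ i : Fin d, (1 + ψ (EuclideanSpace.single i 1))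
    have h1 : Filter.Tendsto (fun n => ψ v ^ (1 - δ n) - f n v) Filter.atTop (nhds 0) := by
      refine squeeze_zero_norm (a := fun n => δ n * B + δ n) (fun n => ?_) ?_
      · have := hfψ n v hv
        rwa [hpα, sub_sub_cancel] at this
      · simpa using (hδl.mul_const B).add hδl
    have h2 : Filter.Tendsto (fun n => ψ v ^ (1 - δ n)) Filter.atTop (nhds (ψ v)) := by
      have h := (tendsto_const_nhds (x := ψ v)).rpow ((tendsto_const_nhds (x := (1 : ℝ))).sub hδl)
        (Or.inr (by norm_num))
      simpa using h
    simpa using h2.sub h1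
  refine ⟨f, hf, fun u => ?_⟩
  -- Homogeneity of both sides carries the convergence from the ball to all `u`; adding `1` keeps
  -- `r` positive at `u = 0`.
  set r : ℝ := ‖u‖ + 1 with hr
  have hr0 : 0 < r := by positivity
  have hu : r • r⁻¹ • u = u := smul_inv_smul₀ hr0.ne' u
  have h := (hball (r⁻¹ • u) (by
    rw [norm_smul, norm_inv, Real.norm_of_nonneg hr0.le, inv_mul_le_iff₀ hr0, mul_one]
    linarith)).const_mul (r ^ α)
  rw [← hψh r hr0.le, hu] at h
  refine h.congr fun n => ?_
  rw [← ellipsoidExponents_apply_smul (hf n) hr0, hu]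

end

theorem mainTheorem11 (d : ℕ) (α : ℝ) (hα : α ∈ Set.Icc (1 : ℝ) 2)
    (μ : ProbabilityMeasure (EuclideanSpace ℝ (Fin d))) :
    IsSymmetricStable α μ ↔
      ∃ ν : ℕ → ProbabilityMeasure (EuclideanSpace ℝ (Fin d)),
        (∀ n, IsSumOfIndepSubGaussianStable α (ν n)) ∧
          Filter.Tendsto ν Filter.atTop (nhds μ) := by
  have hα0 : 0 < α := zero_lt_one.trans_le hα.1
  refine ⟨fun h => ?_, fun ⟨ν, hν, h⟩ => .of_tendsto (fun n => (hν n).isSymmetricStable) h⟩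
  obtain ⟨ψ, hψ0, hψ, hψh⟩ := h.exists_exponent hα0
  obtain ⟨f, hf, hfψ⟩ := exists_seq_ellipsoidExponents_tendsto hα0 hα.2 hψ0 hψ hψh
  choose ν hν hνf using fun n => exists_isSumOfIndepSubGaussianStable hα0 hα.2 (hf n)
  refine ⟨ν, hν, ProbabilityMeasure.tendsto_of_tendsto_charFun fun u => ?_⟩
  simp only [hψ, hνf]
  exact ((Complex.continuous_ofReal.comp Real.continuous_exp).tendsto _).comp (hfψ u).neg
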